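/- Identify a real tangent vector of $\mathbb{C}^2$ (coordinates $(z,w)$) with an element of $\mathbb{R}^4$. For a real-valued smooth function $r$ write $H_r^{\mathbb{R}}(V,W)$ for its real Hessian form on real tangent vectors $V,W$, and $H_r(\xi,\eta)=\sum_{j,k=1}^2\frac{\partial^2 r}{\partial z^j\partial\bar z^k}\,\xi^j\,\overline{\eta^k}$ for its complex Hessian form on holomorphic tangent vectors $\xi=\sum_j\xi^j\frac{\partial}{\partial z^j}$, $\eta=\sum_k\eta^k\frac{\partial}{\partial z^k}$, where $(z^1,z^2)=(z,w)$. Let $\Omega\subset\mathbb{C}^2$ be a domain (not necessarily bounded) with $\mathcal{C}^\infty$-smooth boundary $b\Omega$, and let $p_0\in b\Omega$. A smooth local defining function for $\Omega$ near a point $p\in b\Omega$ is a $\mathcal{C}^\infty$-smooth function $\rho\colon U\to\mathbb{R}$ on an open neighborhood $U$ of $p$ such that $\Omega\cap U=\{\rho<0\}$ and $d\rho\neq0$ on $b\Omega\cap U$. Given such a $\rho$, define at the points of $b\Omega\cap U$ $$L=\frac{\sqrt2}{|\partial\rho|}\Bigl(\rho_w\frac{\partial}{\partial z}-\rho_z\frac{\partial}{\partial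 w}\Bigr),\qquad N=\frac{\sqrt2}{|\partial\rho|}\Bigl(\rho_{\bar z}\frac{\partial}{\partial z}+\rho_{\bar w}\frac{\partial}{\partial w}\Bigr),\qquad |\partial\rho|^2=2\bigl(|\rho_z|^2+|\rho_w|^2\bigr),$$ and let $X,Y,\nu,T$ be the real vectors with $L=\frac12(X+iY)$ and $N=\frac12(\nu+iT)$. Suppose that $\Omega$ is sesquiconvex at $p_0$, that is: (a) $\Omega$ is pseudoconvex at $p_0$: for some smooth local defining function $r$ for $\Omega$ near $p_0$, one has $H_r(\xi,\xi)\ge0$ at all points of $b\Omega$ near $p_0$ for all holomorphic tangent vectors $\xi$ with $\langle\partial r,\xi\rangle=0$; and (b) there is a smooth local defining function $\rho\colon U\to\mathbb{R}$ for $\Omega$ near $p_0$ such that $$H_\rho^{\mathbb{R}}(Y,T)^2+H_\rho^{\mathbb{R}}(X,T)^2=\mathcal{O}\bigl(H_\rho(L,L)\bigr)\quad\text{on } b\Omega\cap U,$$ i.e. for every compact $K\subset b\Omega\cap U$ there is a constant $C>0$ such that the left-hand side is at most $C\,|H_\rho(L,L)|$ on $K$. Then $\Omega$ admits a smooth local defining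 function $\rho\colon U\to\mathbb{R}$ near $p_0$ which is plurisubharmonic on $\overline\Omega\cap U$, i.e. $H_\rho(\xi,\xi)\ge0$ at every point of $\overline\Omega\cap U$ for every $\xi\in\mathbb{C}^2$. -/

import Mathlib

open scoped ContDiff ComplexConjugate

noncomputable section

/-- `ℂ²` with its Euclidean structure; a point is `(z, w) = (q 0, q 1)`. A real tangent vector
`a ∂/∂x + b ∂/∂y + c ∂/∂u + d ∂/∂v` is identified with `(a + i b, c + i d)`, so that the standard
complex structure is multiplication by `i`. -/
abbrev C2 : Type := EuclideanSpace ℂ (Fin 2)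

namespace C2

/-- The `j`-th standard basis vector, i.e. the real direction `∂/∂x^j`; the direction `∂/∂y^j` is
`Complex.I • basisVec j`. -/
def basisVec (j : Fin 2) : C2 := EuclideanSpace.single j (1 : ℂ)

/-- The Wirtinger derivative `∂f/∂z^j = (1/2) (∂f/∂x^j - i ∂f/∂y^j)`. -/
def dz (j : Fin 2) (f : C2 → ℂ) (q : C2) : ℂ :=
  (1 / 2 : ℂ) * (fderiv ℝ f q (basisVec j) - Complex.I * fderiv ℝ f q (Complex.I • basisVec j))

/-- The Wirtinger derivative `∂f/∂z̄^j = (1/2) (∂f/∂x^j + i ∂f/∂y^j)`. -/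
def dzbar (j : Fin 2) (f : C2 → ℂ) (q : C2) : ℂ :=
  (1 / 2 : ℂ) * (fderiv ℝ f q (basisVec j) + Complex.I * fderiv ℝ f q (Complex.I • basisVec j))

/-- A real-valued function regarded as a complex-valued one. -/
def toComplex (r : C2 → ℝ) : C2 → ℂ := fun q => (r q : ℂ)

/-- The real Hessian form `H^ℝ_r(V, W)` at `q`, i.e. the sum of the real second order partial
derivatives of `r`, weighted by the products of the real coordinates of `V` and `W`. -/
def realHessian (r : C2 → ℝ) (q V W : C2) : ℝ := fderiv ℝ (fderiv ℝ r) q V W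

/-- The complex Hessian form `H_r(ξ, η) = ∑ ∂²r/∂z^j∂z̄^k ξ^j conj(η^k)` at `q`, where `ξ` stands
for the holomorphic tangent vector `∑ ξ^j ∂/∂z^j`. -/
def complexHessian (r : C2 → ℝ) (q ξ η : C2) : ℂ :=
  ∑ j : Fin 2, ∑ k : Fin 2, dz j (dzbar k (toComplex r)) q * ξ j * conj (η k)

/-- `⟨∂r, ξ⟩ = ∑ ∂r/∂z^j ξ^j` at `q`. -/
def del (r : C2 → ℝ) (q ξ : C2) : ℂ := ∑ j : Fin 2, dz j (toComplex r) q * ξ j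

/-- The length `|∂r|` at `q`; the forms `dz^j` are orthogonal of length `√2`. -/
def delNorm (r : C2 → ℝ) (q : C2) : ℝ :=
  Real.sqrt (2 * ∑ j : Fin 2, ‖dz j (toComplex r) q‖ ^ 2)

/-- The coefficients of the canonical tangential field
`L_r = (√2 / |∂r|) (r_w ∂/∂z - r_z ∂/∂w)`. -/
def fieldL (r : C2 → ℝ) (q : C2) : C2 :=
  ((Real.sqrt 2 / delNorm r q : ℝ) : ℂ) • !₂[dz 1 (toComplex r) q, -dz 0 (toComplex r) q]

/-- The coefficients of the canonical complex normal field
`N_r = (√2 / |∂r|) (r_z̄ ∂/∂z + r_w̄ ∂/∂w)`. -/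
def fieldN (r : C2 → ℝ) (q : C2) : C2 :=
  ((Real.sqrt 2 / delNorm r q : ℝ) : ℂ) • !₂[dzbar 0 (toComplex r) q, dzbar 1 (toComplex r) q]

/-- The real field `X` with `L_r = (1/2) (X + i Y)`. If `L = a ∂/∂z + b ∂/∂w`, then
`X = 2 Re L = L + conj L` is the real vector identified with `(a, b)`. -/
def fieldX (r : C2 → ℝ) (q : C2) : C2 := fieldL r q

/-- The real field `Y` with `L_r = (1/2) (X + i Y)`, i.e. `Y = -J X`. -/
def fieldY (r : C2 → ℝ) (q : C2) : C2 := -(Complex.I • fieldX r q)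

/-- The real field `T` with `N_r = (1/2) (ν + i T)`, i.e. `T = -J ν`, where `ν = 2 Re N_r` is
the real vector identified with the coefficients of `N_r`. -/
def fieldT (r : C2 → ℝ) (q : C2) : C2 := -(Complex.I • fieldN r q)

/-- `f = O(g)` on `S`: on every compact subset of `S`, `|f| ≤ C |g|` for some constant `C`. -/
def IsBigOOnCompacts (f g : C2 → ℝ) (S : Set C2) : Prop :=
  ∀ K : Set C2, IsCompact K → K ⊆ S → ∃ C : ℝ, 0 < C ∧ ∀ q ∈ K, |f q| ≤ C * |g q|

/-- `r : U → ℝ` is a smooth local defining function for `Ω` near `p`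
(only the values of `r` on `U` matter). -/
structure IsLocalDefiningFunction (Ω : Set C2) (p : C2) (U : Set C2) (r : C2 → ℝ) : Prop where
  isOpen : IsOpen U
  mem : p ∈ U
  smooth : ContDiffOn ℝ ∞ r U
  inter_eq : Ω ∩ U = {q | q ∈ U ∧ r q < 0}
  fderiv_ne_zero : ∀ q ∈ frontier Ω ∩ U, fderiv ℝ r q ≠ 0

/-- A domain with smooth (`C^∞`) boundary, not necessarily a bounded set. -/
structure IsSmoothlyBoundedDomain (Ω : Set C2) : Prop where
  isOpen : IsOpen Ω
  isConnected : IsConnected Ω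
  smooth_boundary : ∀ p ∈ frontier Ω, ∃ (U : Set C2) (r : C2 → ℝ),
    IsLocalDefiningFunction Ω p U r

/-- `Ω` is (Levi) pseudoconvex at the boundary point `p`: at all boundary points near `p`, the
complex Hessian form of a local defining function is nonnegative on complex tangent vectors. -/
def IsPseudoconvexAt (Ω : Set C2) (p : C2) : Prop :=
  ∃ (U : Set C2) (r : C2 → ℝ), IsLocalDefiningFunction Ω p U r ∧
    ∀ᶠ q in nhdsWithin p (frontier Ω),
      ∀ ξ : C2, del r q ξ = 0 → 0 ≤ (complexHessian r q ξ ξ).re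

/-- `Ω` is sesquiconvex at the boundary point `p`: it is pseudoconvex at `p`, and
`H_ρ(Y,T)² + H_ρ(X,T)² = O(H_ρ(L,L))` on `bΩ ∩ U` for some smooth local defining function
`ρ : U → ℝ` for `Ω` near `p`. -/
def IsSesquiconvexAt (Ω : Set C2) (p : C2) : Prop :=
  IsPseudoconvexAt Ω p ∧
    ∃ (U : Set C2) (ρ : C2 → ℝ), IsLocalDefiningFunction Ω p U ρ ∧
      IsBigOOnCompacts
        (fun q => realHessian ρ q (fieldY ρ q) (fieldT ρ q) ^ 2
          + realHessian ρ q (fieldX ρ q) (fieldT ρ q) ^ 2)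
        (fun q => (complexHessian ρ q (fieldL ρ q) (fieldL ρ q)).re)
        (frontier Ω ∩ U)

/-- `r` is plurisubharmonic on the set `S`, in the sense that its complex Hessian form is positive
semi-definite at each point of `S` (for `r` smooth on a neighbourhood of `S`). -/
def IsPlurisubharmonicOn (r : C2 → ℝ) (S : Set C2) : Prop :=
  ∀ q ∈ S, ∀ ξ : C2, 0 ≤ (complexHessian r q ξ ξ).re

end C2

end

/-! The function `δ + K δ²` works for large `K`, where `δ` is the signed distance to the boundary
(negative in `Ω`). The real Hessian of `δ` is the shape operator `A = dN`, which is symmetric and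
kills the normal `N`. Up to the factor 1/4, the complex Hessian of `δ` on `ξ` is therefore `⟨Aξ, ξ⟩
+ ⟨A(iξ), iξ⟩`.

On the boundary, the Hessian of any defining function restricted to real tangent vectors is its
normal derivative times the second fundamental form (`fderiv_fderiv_eq_of_comp_proj_eq_zero`). Since
`X`, `Y`, `T` are all tangent, both hypotheses become statements about `A` alone, even though they
come from different defining functions: the Levi term `F = ⟨AX, X⟩ + ⟨AY, Y⟩` is nonnegative, and
`⟨AX, T⟩² + ⟨AY, T⟩²` is at most a constant times `F`.

The crux is to carry this estimate to interior points. With `A₀` the shape operator at the foot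
point and `t = -δ ≥ 0`, one has `A = A₀ + t A₀ A` (`fderiv_normal_proj`). Moving inwards thus
increases `F` by at least `(t/2)(‖AX‖² + ‖AY‖²)`, while the squared mixed terms pick up errors of
size only `t²(‖AX‖² + ‖AY‖²)`, which the gain absorbs (`mixed_sq_le_levi_of_resolvent`).

Once the mixed terms are dominated by `F`, Cauchy–Schwarz bounds the Hessian of `δ` below by a
negative constant times the squared complex normal component of `ξ` (`levi_lower_bound`). The
rank-one terms `2K⟨N, ·⟩²` produced by `K δ²` compensate this deficit. -/

open Filter Topology Set InnerProductSpace

/-! ### Smooth local inverses -/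

section LocalInverse

variable {E F : Type*} [NormedAddCommGroup E] [NormedSpace ℝ E] [CompleteSpace E]
  [NormedAddCommGroup F] [NormedSpace ℝ F]

/-- The inverse function theorem for smooth maps, with smoothness of the inverse on a
neighbourhood. -/
theorem exists_smooth_local_inverse {f : E → F} {a : E} (hf : ∀ᶠ x in 𝓝 a, ContDiffAt ℝ ∞ f x)
    (e : E ≃L[ℝ] F) (he : HasFDerivAt f (e : E →L[ℝ] F) a) :
    ∃ g : F → E, g (f a) = a ∧ (∀ᶠ y in 𝓝 (f a), ContDiffAt ℝ ∞ g y) ∧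
      (∀ᶠ y in 𝓝 (f a), f (g y) = y) ∧ ∀ᶠ x in 𝓝 a, g (f x) = x := by
  have ha : ContDiffAt ℝ ∞ f a := hf.self_of_nhds
  set Φ := ha.toOpenPartialHomeomorph f he (by simp) with hΦ
  have hcoe : (Φ : E → F) = f := ha.toOpenPartialHomeomorph_coe he (by simp)
  have hsrc : a ∈ Φ.source := ha.mem_toOpenPartialHomeomorph_source he (by simp)
  have htgt : f a ∈ Φ.target := by
    have := Φ.map_source hsrc
    rwa [hcoe] at this
  have hinv : Φ.symm (f a) = a := by
    have := Φ.left_inv hsrc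
    rwa [hcoe] at this
  refine ⟨Φ.symm, hinv, ?_, ?_, ?_⟩
  · have hcont : ContinuousAt (fderiv ℝ f) a :=
      (ha.fderiv_right (m := 0) (by simp)).continuousAt
    -- Invertibility of the derivative is an open condition, which gives smoothness of the inverse
    -- on a whole neighbourhood rather than at one point.
    have hev : ∀ᶠ x in 𝓝 a, fderiv ℝ f x ∈ Set.range
        (ContinuousLinearEquiv.toContinuousLinearMap : (E ≃L[ℝ] F) → E →L[ℝ] F) := by
      apply hcont.eventually_mem
      rw [he.fderiv]
      exact ContinuousLinearEquiv.nhds e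
    have htend : Tendsto Φ.symm (𝓝 (f a)) (𝓝 a) := by
      have := Φ.continuousAt_symm htgt
      rwa [ContinuousAt, hinv] at this
    filter_upwards [htend.eventually (hev.and hf), Φ.open_target.mem_nhds htgt]
      with y hy hyt
    obtain ⟨⟨e', he'⟩, hfy⟩ := hy
    refine Φ.contDiffAt_symm (f₀' := e') hyt ?_ ?_
    · rw [hcoe]
      have := (hfy.differentiableAt (by simp)).hasFDerivAt
      rwa [← he'] at this
    · rwa [hcoe]
  · filter_upwards [Φ.open_target.mem_nhds htgt] with y hy
    have := Φ.right_inv hy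
    rwa [hcoe] at this
  · filter_upwards [Φ.open_source.mem_nhds hsrc] with x hx
    have := Φ.left_inv hx
    rwa [hcoe] at this

end LocalInverse

/-! ### Foot point projection and signed distance -/

section NormalProjection

variable {E : Type*} [NormedAddCommGroup E] [InnerProductSpace ℝ E]

/-- On the open set `W`, the point `π x` is the foot of `x` on a hypersurface, `δ x` is the signed
distance from `x` to the hypersurface, and `N x` is the unit normal at `π x`. -/
structure IsNormalProjection (W : Set E) (π : E → E) (δ : E → ℝ) (N : E → E) : Prop where
  isOpen : IsOpen W
  mapsTo : MapsTo π W W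
  smooth_proj : ContDiffOn ℝ ∞ π W
  smooth_dist : ContDiffOn ℝ ∞ δ W
  smooth_normal : ContDiffOn ℝ ∞ N W
  decomp : ∀ x ∈ W, π x + δ x • N x = x
  normal_proj : ∀ x ∈ W, N (π x) = N x
  dist_proj : ∀ x ∈ W, δ (π x) = 0
  fderiv_dist : ∀ x ∈ W, ∀ v, fderiv ℝ δ x v = inner ℝ (N x) v
  norm_normal : ∀ x ∈ W, ‖N x‖ = 1

theorem contDiffAt_normalized_gradient [CompleteSpace E] {f : E → ℝ} {x : E}
    (hf : ContDiffAt ℝ ∞ f x) (h0 : gradient f x ≠ 0) :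
    ContDiffAt ℝ ∞ (fun y => ‖gradient f y‖⁻¹ • gradient f y) x := by
  have hg : ContDiffAt ℝ ∞ (gradient f) x := by
    have h1 : ContDiffAt ℝ ∞ (fderiv ℝ f) x := hf.fderiv_right (by simp)
    exact ((toDual ℝ E).symm.toContinuousLinearEquiv.contDiff.contDiffAt).comp x h1
  exact ((hg.norm ℝ h0).inv (norm_ne_zero_iff.mpr h0)).smul hg

theorem inner_gradient_left_real [CompleteSpace E] (f : E → ℝ) (x v : E) :
    inner ℝ (gradient f x) v = fderiv ℝ f x v := by
  simp [gradient]

/-- The shear `(v, s) ↦ (v + s n, ℓ v)` is invertible if `ℓ n ≠ 0`. -/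
noncomputable def shearEquiv (n : E) (l : E →L[ℝ] ℝ) (h : l n ≠ 0) : (E × ℝ) ≃L[ℝ] (E × ℝ) :=
  ContinuousLinearEquiv.equivOfInverse
    ((ContinuousLinearMap.fst ℝ E ℝ + (ContinuousLinearMap.snd ℝ E ℝ).smulRight n).prod
      (l.comp (ContinuousLinearMap.fst ℝ E ℝ)))
    ((ContinuousLinearMap.fst ℝ E ℝ
        - ((l n)⁻¹ • (l.comp (ContinuousLinearMap.fst ℝ E ℝ)
          - ContinuousLinearMap.snd ℝ E ℝ)).smulRight n).prod
      ((l n)⁻¹ • (l.comp (ContinuousLinearMap.fst ℝ E ℝ) - ContinuousLinearMap.snd ℝ E ℝ)))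
    (by
      rintro ⟨v, s⟩
      have : (l n)⁻¹ * (s * l n) = s := by field_simp
      simp [this])
    (by
      rintro ⟨v, s⟩
      have : l v - (l n)⁻¹ * (l v - s) * l n = s := by field_simp; ring
      simp [this])

variable [CompleteSpace E]

/-- A smooth hypersurface `{f = 0}` has, near each of its regular points, a smooth foot point
projection and a smooth signed distance function. -/
theorem exists_isNormalProjection {f : E → ℝ} {p : E}
    (hf : ∀ᶠ x in 𝓝 p, ContDiffAt ℝ ∞ f x) (hp : f p = 0) (hdf : fderiv ℝ f p ≠ 0)
    {S : Set E} (hS : S ∈ 𝓝 p) :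
    ∃ (W : Set E) (π : E → E) (δ : E → ℝ) (N : E → E), IsNormalProjection W π δ N ∧ p ∈ W ∧
      W ⊆ S ∧ ∀ x ∈ W, (f x < 0 ↔ δ x < 0) ∧ (f x = 0 ↔ δ x = 0) := by
  set n : E → E := fun y => ‖gradient f y‖⁻¹ • gradient f y with hn
  have hfp : ContDiffAt ℝ ∞ f p := hf.self_of_nhds
  have hgp : gradient f p ≠ 0 := by
    intro h
    apply hdf
    ext v
    rw [← inner_gradient_left_real, h]
    simp
  have hgc : ContinuousAt (gradient f) p := by
    have h1 : ContDiffAt ℝ ∞ (fderiv ℝ f) p := hfp.fderiv_right (by simp)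
    exact ((toDual ℝ E).symm.continuous.continuousAt).comp h1.continuousAt
  have hg0 : ∀ᶠ x in 𝓝 p, gradient f x ≠ 0 := hgc.eventually_ne hgp
  have hn1 : ∀ᶠ x in 𝓝 p, ‖n x‖ = 1 := by
    filter_upwards [hg0] with x hx
    simp [hn, norm_smul, hx]
  have hns : ∀ᶠ x in 𝓝 p, ContDiffAt ℝ ∞ n x := by
    filter_upwards [hg0, hf] with x hx hfx using contDiffAt_normalized_gradient hfx hx
  have hdn : ∀ x v, fderiv ℝ f x v = ‖gradient f x‖ * inner ℝ (n x) v := by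
    intro x v
    by_cases hx : gradient f x = 0
    · rw [← inner_gradient_left_real, hx]; simp
    · rw [hn, real_inner_smul_left, ← inner_gradient_left_real, ← mul_assoc,
        mul_inv_cancel₀ (norm_ne_zero_iff.mpr hx), one_mul]
  have hfn : fderiv ℝ f p (n p) = ‖gradient f p‖ := by
    rw [hdn, real_inner_self_eq_norm_sq, hn1.self_of_nhds]; simp
  have hfn0 : 0 < fderiv ℝ f p (n p) := by rw [hfn]; exact norm_pos_iff.mpr hgp
  -- Inverting `F` at `(x, 0)` yields foot point and distance together: the second component forces
  -- the foot point onto `{f = 0}`, the first says that `x` lies on the normal line there.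
  set F : E × ℝ → E × ℝ := fun q => (q.1 + q.2 • n q.1, f q.1) with hF
  have hF0 : F (p, 0) = (p, 0) := by simp [hF, hp]
  have hFs : ∀ᶠ q in 𝓝 (p, (0 : ℝ)), ContDiffAt ℝ ∞ F q := by
    have : Tendsto (Prod.fst : E × ℝ → E) (𝓝 (p, (0 : ℝ))) (𝓝 p) := continuous_fst.tendsto' _ _ rfl
    filter_upwards [this.eventually (hns.and hf)] with q hq
    have h1 : ContDiffAt ℝ ∞ (fun q : E × ℝ => n q.1) q := hq.1.comp q contDiffAt_fst
    have h2 : ContDiffAt ℝ ∞ (fun q : E × ℝ => f q.1) q := hq.2.comp q contDiffAt_fst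
    exact (contDiffAt_fst.add (contDiffAt_snd.smul h1)).prodMk h2
  have hFd : HasFDerivAt F (shearEquiv (n p) (fderiv ℝ f p) hfn0.ne' : (E × ℝ) →L[ℝ] (E × ℝ))
      (p, 0) := by
    have h1 : HasFDerivAt (fun q : E × ℝ => n q.1)
        ((fderiv ℝ n p).comp (ContinuousLinearMap.fst ℝ E ℝ)) (p, 0) :=
      HasFDerivAt.comp (p, (0 : ℝ)) (g := n)
        (hns.self_of_nhds.differentiableAt (by simp)).hasFDerivAt hasFDerivAt_fst
    have h2 : HasFDerivAt (fun q : E × ℝ => f q.1)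
        ((fderiv ℝ f p).comp (ContinuousLinearMap.fst ℝ E ℝ)) (p, 0) :=
      HasFDerivAt.comp (p, (0 : ℝ)) (g := f)
        (hfp.differentiableAt (by simp)).hasFDerivAt hasFDerivAt_fst
    have h3 := (hasFDerivAt_fst.add (hasFDerivAt_snd.smul h1)).prodMk h2
    refine h3.congr_fderiv ?_
    ext v <;> simp [shearEquiv]
  obtain ⟨g, hg1, hgs, hgr, hgl⟩ := exists_smooth_local_inverse hFs _ hFd
  rw [hF0] at hg1 hgs hgr
  have hι : Tendsto (fun x : E => (x, (0 : ℝ))) (𝓝 p) (𝓝 (p, 0)) :=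
    Continuous.tendsto (by fun_prop) p
  set π : E → E := fun x => (g (x, 0)).1 with hπ
  set δ : E → ℝ := fun x => (g (x, 0)).2 with hδ
  have hgx : ∀ᶠ x in 𝓝 p, ContDiffAt ℝ ∞ (fun x => g (x, (0 : ℝ))) x := by
    filter_upwards [hι.eventually hgs] with x hx
    exact hx.comp x (contDiffAt_id.prodMk contDiffAt_const)
  have hπs : ∀ᶠ x in 𝓝 p, ContDiffAt ℝ ∞ π x := by
    filter_upwards [hgx] with x hx using hx.fst
  have hδs : ∀ᶠ x in 𝓝 p, ContDiffAt ℝ ∞ δ x := by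
    filter_upwards [hgx] with x hx using hx.snd
  have hπp : π p = p := by simp [hπ, hg1]
  have hπt : Tendsto π (𝓝 p) (𝓝 p) := by
    have := hπs.self_of_nhds.continuousAt
    rwa [ContinuousAt, hπp] at this
  have hdec : ∀ᶠ x in 𝓝 p, π x + δ x • n (π x) = x ∧ f (π x) = 0 := by
    filter_upwards [hι.eventually hgr] with x hx
    simpa [hF, Prod.ext_iff] using hx
  have hfix : ∀ᶠ x in 𝓝 p, f x = 0 → π x = x ∧ δ x = 0 := by
    filter_upwards [hι.eventually hgl] with x hx hfx
    have : F (x, 0) = (x, 0) := by simp [hF, hfx]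
    rw [this] at hx
    simp [hπ, hδ, hx]
  have hNs : ∀ᶠ x in 𝓝 p, ContDiffAt ℝ ∞ (fun x => n (π x)) x := by
    filter_upwards [hπt.eventually hns, hπs] with x h1 h2 using h1.comp x h2
  have hgrad : ∀ᶠ x in 𝓝 p, ∀ v, fderiv ℝ δ x v = inner ℝ (n (π x)) v := by
    filter_upwards [hNs, hπs, hδs, hdec.eventually_nhds, (hπt.eventually hn1).eventually_nhds,
      hπt.eventually hg0, hπt.eventually hf] with x hN hP hD hde hno hg hfx v
    have dN := (hN.differentiableAt (by simp)).hasFDerivAt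
    have dP := (hP.differentiableAt (by simp)).hasFDerivAt
    have dD := (hD.differentiableAt (by simp)).hasFDerivAt
    have dF := (hfx.differentiableAt (by simp)).hasFDerivAt
    have e1 : inner ℝ (n (π x)) (fderiv ℝ π x v) = 0 := by
      have h1 := dF.comp x dP
      have h2 : HasFDerivAt (f ∘ π) (0 : E →L[ℝ] ℝ) x := by
        refine (hasFDerivAt_const (0 : ℝ) x).congr_of_eventuallyEq ?_
        filter_upwards [hde] with y hy using hy.2
      have h3 := congrArg (fun l => l v) (h1.unique h2)
      simp only [ContinuousLinearMap.comp_apply, zero_apply] at h3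
      rw [hdn] at h3
      exact (mul_eq_zero.mp h3).resolve_left (norm_ne_zero_iff.mpr hg)
    have e2 : inner ℝ (n (π x)) (fderiv ℝ (fun x => n (π x)) x v) = 0 := by
      have h1 := dN.inner ℝ dN
      have h2 : HasFDerivAt (fun t => inner ℝ (n (π t)) (n (π t))) (0 : E →L[ℝ] ℝ) x := by
        refine (hasFDerivAt_const (1 : ℝ) x).congr_of_eventuallyEq ?_
        filter_upwards [hno] with y hy
        rw [real_inner_self_eq_norm_sq, hy]; simp
      have h3 := congrArg (fun l => l v) (h1.unique h2)
      simp [fderivInnerCLM_apply] at h3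
      rw [real_inner_comm] at h3
      rw [real_inner_comm]
      linarith [real_inner_comm (n (π x)) ((fderiv ℝ (fun x ↦ n (π x)) x) v)]
    -- Differentiate `π + δ n(π) = id` and pair with `n(π x)`: the contributions of `dπ` and of `d(n
    -- ∘ π)` vanish by `e1` and `e2`, leaving `dδ`.
    have h1 := dP.add (dD.smul dN)
    have h2 : HasFDerivAt (π + fun t => δ t • n (π t)) (ContinuousLinearMap.id ℝ E) x := by
      refine (hasFDerivAt_id x).congr_of_eventuallyEq ?_
      filter_upwards [hde] with y hy using hy.1
    have h3 := congrArg (fun l => inner ℝ (n (π x)) (l v)) (h1.unique h2)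
    simp only [add_apply, smul_apply, inner_add_right,
      ContinuousLinearMap.smulRight_apply, real_inner_smul_right, e1, e2,
      ContinuousLinearMap.id_apply, real_inner_self_eq_norm_sq, hno.self_of_nhds] at h3
    linarith
  have hpos : ∀ᶠ q : E × E in 𝓝 (p, p), 0 < fderiv ℝ f q.1 (n q.2) := by
    have hc : ContinuousAt (fun q : E × E => fderiv ℝ f q.1 (n q.2)) (p, p) := by
      have h1 : ContinuousAt (fderiv ℝ f) p :=
        (hfp.fderiv_right (m := 0) (by simp)).continuousAt
      have h2 : ContinuousAt n p := hns.self_of_nhds.continuousAt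
      have h3 : ContinuousAt (fun q : E × E => fderiv ℝ f q.1) (p, p) :=
        ContinuousAt.comp (g := fderiv ℝ f) h1 continuousAt_fst
      have h4 : ContinuousAt (fun q : E × E => n q.2) (p, p) :=
        ContinuousAt.comp (g := n) h2 continuousAt_snd
      exact h3.clm_apply h4
    exact hc.eventually (lt_mem_nhds hfn0)
  obtain ⟨ε, hε, hball⟩ : ∃ ε > 0, ∀ a ∈ Metric.ball p ε, ∀ b ∈ Metric.ball p ε,
      0 < fderiv ℝ f a (n b) ∧ ContDiffAt ℝ ∞ f a := by
    obtain ⟨ε, hε, h⟩ := Metric.eventually_nhds_iff_ball.mp (hpos.and (hf.prod_inl_nhds p))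
    refine ⟨ε, hε, fun a ha b hb => h (a, b) ?_⟩
    rw [← ball_prod_same]
    exact ⟨ha, hb⟩
  have hsign : ∀ᶠ x in 𝓝 p, (f x < 0 ↔ δ x < 0) ∧ (f x = 0 ↔ δ x = 0) := by
    filter_upwards [Metric.ball_mem_nhds p hε, hπt.eventually (Metric.ball_mem_nhds p hε), hdec]
      with x hx hpx hde
    -- Mean value theorem on the segment from `π x` to `x`: `f x` is `δ x` times the derivative of
    -- `f` at `z` along `n (π x)`, a positive factor, so `f` and `δ` have the same sign.
    obtain ⟨z, hz, h⟩ := domain_mvt (f := f) (f' := fun y => fderiv ℝ f y) (s := Metric.ball p ε)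
      (fun y hy => ((hball y hy y hy).2.differentiableAt (by simp)).hasFDerivAt.hasFDerivWithinAt)
      (convex_ball p ε) hpx hx
    have hz' : z ∈ Metric.ball p ε := (convex_ball p ε).segment_subset hpx hx hz
    have hk := (hball z hz' (π x) hpx).1
    have hsub : x - π x = δ x • n (π x) := sub_eq_of_eq_add' hde.1.symm
    rw [hde.2, sub_zero, hsub, map_smul, smul_eq_mul] at h
    rw [h]
    constructor
    · constructor
      · intro h1; by_contra! h2; exact absurd h1 (not_lt.mpr (mul_nonneg h2 hk.le))
      · intro h1; exact mul_neg_of_neg_of_pos h1 hk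
    · simp [hk.ne']
  have hall := ((((((hπs.and hδs).and hNs).and hdec).and hfix).and hgrad).and
    ((hπt.eventually hn1).and hsign)).and (eventually_mem_set.mpr hS)
  obtain ⟨W₀, hW₀, hW₀o, hpW₀⟩ := eventually_nhds_iff.mp hall
  have hπc : ContinuousOn π W₀ := fun x hx =>
    ((hW₀ x hx).1.1.1.1.1.1.1).continuousAt.continuousWithinAt
  have hid : ∀ x ∈ W₀ ∩ π ⁻¹' W₀, π (π x) = π x ∧ δ (π x) = 0 := fun x hx =>
    (hW₀ (π x) hx.2).1.1.1.2 (hW₀ x hx.1).1.1.1.1.2.2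
  -- Since `π` is idempotent here, intersecting with the preimage makes the neighbourhood stable
  -- under `π`.
  refine ⟨W₀ ∩ π ⁻¹' W₀, π, δ, fun x => n (π x), ⟨hπc.isOpen_inter_preimage hW₀o hW₀o, ?_, ?_,
    ?_, ?_, ?_, ?_, ?_, ?_, ?_⟩, ⟨hpW₀, by simpa [hπp] using hpW₀⟩, ?_, ?_⟩
  · intro x hx
    exact ⟨hx.2, by simpa [(hid x hx).1] using hx.2⟩
  · exact fun x hx => ((hW₀ x hx.1).1.1.1.1.1.1.1).contDiffWithinAt
  · exact fun x hx => ((hW₀ x hx.1).1.1.1.1.1.1.2).contDiffWithinAt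
  · exact fun x hx => ((hW₀ x hx.1).1.1.1.1.1.2).contDiffWithinAt
  · exact fun x hx => (hW₀ x hx.1).1.1.1.1.2.1
  · exact fun x hx => by simp [(hid x hx).1]
  · exact fun x hx => (hid x hx).2
  · exact fun x hx => (hW₀ x hx.1).1.1.2
  · exact fun x hx => (hW₀ x hx.1).1.2.1
  · exact fun x hx => (hW₀ x hx.1).2
  · exact fun x hx => (hW₀ x hx.1).1.2.2

end NormalProjection

/-! ### Calculus of the shape operator -/

namespace IsNormalProjection

variable {E : Type*} [NormedAddCommGroup E] [InnerProductSpace ℝ E]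
  {W : Set E} {π : E → E} {δ : E → ℝ} {N : E → E} (h : IsNormalProjection W π δ N) {x : E}

include h

theorem contDiffAt_proj (hx : x ∈ W) : ContDiffAt ℝ ∞ π x :=
  h.smooth_proj.contDiffAt (h.isOpen.mem_nhds hx)

theorem contDiffAt_dist (hx : x ∈ W) : ContDiffAt ℝ ∞ δ x :=
  h.smooth_dist.contDiffAt (h.isOpen.mem_nhds hx)

theorem contDiffAt_normal (hx : x ∈ W) : ContDiffAt ℝ ∞ N x :=
  h.smooth_normal.contDiffAt (h.isOpen.mem_nhds hx)

theorem hasFDerivAt_proj (hx : x ∈ W) : HasFDerivAt π (fderiv ℝ π x) x :=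
  ((h.contDiffAt_proj hx).differentiableAt (by simp)).hasFDerivAt

theorem hasFDerivAt_dist (hx : x ∈ W) : HasFDerivAt δ (fderiv ℝ δ x) x :=
  ((h.contDiffAt_dist hx).differentiableAt (by simp)).hasFDerivAt

theorem hasFDerivAt_normal (hx : x ∈ W) : HasFDerivAt N (fderiv ℝ N x) x :=
  ((h.contDiffAt_normal hx).differentiableAt (by simp)).hasFDerivAt

theorem eventually_mem (hx : x ∈ W) : ∀ᶠ y in 𝓝 x, y ∈ W := h.isOpen.mem_nhds hx

theorem proj_eq_self (hx : x ∈ W) (h0 : δ x = 0) : π x = x := by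
  simpa [h0] using h.decomp x hx

theorem fderiv_dist_eq (hx : x ∈ W) : fderiv ℝ δ x = innerSL ℝ (N x) := by
  ext v
  simpa using h.fderiv_dist x hx v

theorem fderiv_fderiv_dist (hx : x ∈ W) (v w : E) :
    fderiv ℝ (fderiv ℝ δ) x v w = inner ℝ (fderiv ℝ N x v) w := by
  have h1 : HasFDerivAt (fun y => innerSL ℝ (N y)) ((innerSL ℝ).comp (fderiv ℝ N x)) x :=
    (innerSL ℝ : E →L[ℝ] E →L[ℝ] ℝ).hasFDerivAt.comp x (h.hasFDerivAt_normal hx)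
  have h2 : fderiv ℝ δ =ᶠ[𝓝 x] fun y => innerSL ℝ (N y) := by
    filter_upwards [h.eventually_mem hx] with y hy using h.fderiv_dist_eq hy
  rw [h2.fderiv_eq, h1.fderiv]
  simp

/-- The shape operator is the Hessian of `δ`, so this is the symmetry of second derivatives. -/
theorem inner_fderiv_normal_comm (hx : x ∈ W) (v w : E) :
    inner ℝ (fderiv ℝ N x v) w = inner ℝ (fderiv ℝ N x w) v := by
  rw [← h.fderiv_fderiv_dist hx, ← h.fderiv_fderiv_dist hx]
  exact (h.contDiffAt_dist hx).isSymmSndFDerivAt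
    (by rw [minSmoothness_of_isRCLikeNormedField]; exact WithTop.coe_le_coe.2 le_top) v w

theorem inner_fderiv_normal_normal (hx : x ∈ W) (v : E) :
    inner ℝ (fderiv ℝ N x v) (N x) = 0 := by
  have dN := h.hasFDerivAt_normal hx
  have h1 := dN.inner ℝ dN
  have h2 : HasFDerivAt (fun t => inner ℝ (N t) (N t)) (0 : E →L[ℝ] ℝ) x := by
    refine (hasFDerivAt_const (1 : ℝ) x).congr_of_eventuallyEq ?_
    filter_upwards [h.eventually_mem hx] with y hy
    rw [real_inner_self_eq_norm_sq, h.norm_normal y hy]; simp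
  have h3 := congrArg (fun l => l v) (h1.unique h2)
  simp only [ContinuousLinearMap.comp_apply, ContinuousLinearMap.prod_apply,
    fderivInnerCLM_apply, zero_apply] at h3
  linarith [real_inner_comm (N x) (fderiv ℝ N x v)]

/-- The shape operator is symmetric and, as `N` has unit length, takes values orthogonal to `N`. -/
theorem fderiv_normal_normal (hx : x ∈ W) : fderiv ℝ N x (N x) = 0 := by
  refine ext_inner_right ℝ fun w => ?_
  rw [h.inner_fderiv_normal_comm hx, h.inner_fderiv_normal_normal hx, inner_zero_left]

theorem fderiv_decomp (hx : x ∈ W) (v : E) :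
    fderiv ℝ π x v + inner ℝ (N x) v • N x + δ x • fderiv ℝ N x v = v := by
  have h1 := (h.hasFDerivAt_proj hx).add ((h.hasFDerivAt_dist hx).smul (h.hasFDerivAt_normal hx))
  have h2 : HasFDerivAt (π + fun t => δ t • N t) (ContinuousLinearMap.id ℝ E) x := by
    refine (hasFDerivAt_id x).congr_of_eventuallyEq ?_
    filter_upwards [h.eventually_mem hx] with y hy using h.decomp y hy
  have h3 := congrArg (fun l => l v) (h1.unique h2)
  simp only [add_apply, smul_apply, ContinuousLinearMap.smulRight_apply,
    ContinuousLinearMap.id_apply, h.fderiv_dist x hx] at h3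
  rw [← add_assoc, add_right_comm] at h3
  exact h3

theorem fderiv_normal_eq_comp (hx : x ∈ W) (v : E) :
    fderiv ℝ N x v = fderiv ℝ N (π x) (fderiv ℝ π x v) := by
  have h1 := (h.hasFDerivAt_normal (h.mapsTo hx)).comp x (h.hasFDerivAt_proj hx)
  have h2 : HasFDerivAt (N ∘ π) (fderiv ℝ N x) x := by
    refine (h.hasFDerivAt_normal hx).congr_of_eventuallyEq ?_
    filter_upwards [h.eventually_mem hx] with y hy using h.normal_proj y hy
  exact congrArg (fun l => l v) (h2.unique h1)

/-- The shape operator at `x` in terms of the shape operator at the foot point of `x`. -/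
theorem fderiv_normal_proj (hx : x ∈ W) (v : E) :
    fderiv ℝ N x v = fderiv ℝ N (π x) v - δ x • fderiv ℝ N (π x) (fderiv ℝ N x v) := by
  have h1 := h.fderiv_normal_normal (h.mapsTo hx)
  rw [h.normal_proj x hx] at h1
  have h2 := congrArg (fderiv ℝ N (π x)) (h.fderiv_decomp hx v)
  rw [map_add, map_add, map_smul, map_smul, h1, smul_zero, add_zero,
    ← h.fderiv_normal_eq_comp hx] at h2
  exact eq_sub_of_add_eq h2

theorem fderiv_proj_of_dist_eq_zero (hx : x ∈ W) (h0 : δ x = 0) (v : E) :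
    fderiv ℝ π x v = v - inner ℝ (N x) v • N x := by
  have := h.fderiv_decomp hx v
  rw [h0, zero_smul, add_zero] at this
  exact eq_sub_of_add_eq this

variable {r : E → ℝ}

/-- A function that vanishes on the hypersurface has normal gradient there. -/
theorem fderiv_eq_of_comp_proj_eq_zero (hr : ∀ y ∈ W, ContDiffAt ℝ ∞ r y)
    (hr0 : ∀ y ∈ W, r (π y) = 0) (hx : x ∈ W) (h0 : δ x = 0) (v : E) :
    fderiv ℝ r x v = fderiv ℝ r x (N x) * inner ℝ (N x) v := by
  have h1 : HasFDerivAt r (fderiv ℝ r (π x)) (π x) :=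
    ((hr _ (h.mapsTo hx)).differentiableAt (by simp)).hasFDerivAt
  have h2 := h1.comp x (h.hasFDerivAt_proj hx)
  have h3 : HasFDerivAt (r ∘ π) (0 : E →L[ℝ] ℝ) x := by
    refine (hasFDerivAt_const (0 : ℝ) x).congr_of_eventuallyEq ?_
    filter_upwards [h.eventually_mem hx] with y hy using hr0 y hy
  have h4 := congrArg (fun l => l v) (h2.unique h3)
  simp only [ContinuousLinearMap.comp_apply, zero_apply, h.proj_eq_self hx h0,
    h.fderiv_proj_of_dist_eq_zero hx h0, map_sub, map_smul, smul_eq_mul] at h4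
  linarith

/-- The second fundamental form computed from any function vanishing on the hypersurface. -/
theorem fderiv_fderiv_eq_of_comp_proj_eq_zero (hr : ∀ y ∈ W, ContDiffAt ℝ ∞ r y)
    (hr0 : ∀ y ∈ W, r (π y) = 0) (hx : x ∈ W) (h0 : δ x = 0) {v w : E}
    (hv : inner ℝ (N x) v = 0) (hw : inner ℝ (N x) w = 0) :
    fderiv ℝ (fderiv ℝ r) x v w = fderiv ℝ r x (N x) * inner ℝ (fderiv ℝ N x v) w := by
  have hπx := h.proj_eq_self hx h0
  have dr : HasFDerivAt (fderiv ℝ r) (fderiv ℝ (fderiv ℝ r) x) (π x) := by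
    have : ContDiffAt ℝ ∞ (fderiv ℝ r) x := (hr x hx).fderiv_right (by simp)
    rw [hπx]
    exact (this.differentiableAt (by simp)).hasFDerivAt
  have dG := dr.comp x (h.hasFDerivAt_proj hx)
  have dN := h.hasFDerivAt_normal hx
  have dL := dG.clm_apply (hasFDerivAt_const w x)
  have dR := (dG.clm_apply dN).mul (dN.inner ℝ (hasFDerivAt_const w x))
  -- At foot points the gradient of `r` is normal. Differentiating this identity along `v`, the term
  -- containing the derivative of the normal derivative of `r` carries the factor `⟨N, w⟩ = 0`.
  have heq : (fun y => (fderiv ℝ r ∘ π) y w) =ᶠ[𝓝 x]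
      (fun y => (fderiv ℝ r ∘ π) y (N y)) * fun y => inner ℝ (N y) w := by
    filter_upwards [h.eventually_mem hx] with y hy
    have := h.fderiv_eq_of_comp_proj_eq_zero hr hr0 (h.mapsTo hy) (h.dist_proj y hy) w
    rw [h.normal_proj y hy] at this
    exact this
  have h3 := congrArg (fun l => l v) (dL.unique (dR.congr_of_eventuallyEq heq))
  have hP : fderiv ℝ π x v = v := by
    rw [h.fderiv_proj_of_dist_eq_zero hx h0, hv, zero_smul, sub_zero]
  simpa [hP, hπx, hw, fderivInnerCLM_apply] using h3

end IsNormalProjection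

/-! ### Transport of the estimate from the boundary to the interior -/

section Operator

variable {E : Type*} [NormedAddCommGroup E] [InnerProductSpace ℝ E] {A A₀ : E →L[ℝ] E} {t M : ℝ}

/-- Using the resolvent identity twice gives `⟨Av, v⟩ = ⟨A₀v, v⟩ + t‖Av‖² - t²⟨Av, A₀Av⟩`, and `t M
≤ 1/2` lets the last term consume at most half of the gain `t‖Av‖²`. -/
theorem inner_le_of_resolvent (hsymm : ∀ v w, inner ℝ (A₀ v) w = inner ℝ (A₀ w) v)
    (hA : ∀ v, A v = A₀ v + t • A₀ (A v)) (hM : ‖A₀‖ ≤ M) (ht : 0 ≤ t) (htM : t * M ≤ 1 / 2)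
    (v : E) : inner ℝ (A₀ v) v + t / 2 * ‖A v‖ ^ 2 ≤ inner ℝ (A v) v := by
  have h1 : inner ℝ (A v) v = inner ℝ (A₀ v) v + t * inner ℝ (A v) (A₀ v) := by
    conv_lhs => rw [hA v]
    rw [inner_add_left, real_inner_smul_left, hsymm (A v) v, real_inner_comm (A v)]
  have h2 : A₀ v = A v - t • A₀ (A v) := eq_sub_of_add_eq (hA v).symm
  have h3 : inner ℝ (A v) (A₀ v) = ‖A v‖ ^ 2 - t * inner ℝ (A v) (A₀ (A v)) := by
    rw [h2, inner_sub_right, real_inner_smul_right, real_inner_self_eq_norm_sq]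
  have h4 : inner ℝ (A v) (A₀ (A v)) ≤ M * ‖A v‖ ^ 2 := by
    calc inner ℝ (A v) (A₀ (A v)) ≤ ‖A v‖ * ‖A₀ (A v)‖ := real_inner_le_norm _ _
      _ ≤ ‖A v‖ * (M * ‖A v‖) := by
        gcongr
        exact A₀.le_of_opNorm_le hM _
      _ = M * ‖A v‖ ^ 2 := by ring
  have h5 : t * inner ℝ (A v) (A₀ (A v)) ≤ 1 / 2 * ‖A v‖ ^ 2 := by
    calc t * inner ℝ (A v) (A₀ (A v)) ≤ t * (M * ‖A v‖ ^ 2) := by gcongr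
      _ = (t * M) * ‖A v‖ ^ 2 := by ring
      _ ≤ 1 / 2 * ‖A v‖ ^ 2 := by gcongr
  have h6 : t * (1 / 2 * ‖A v‖ ^ 2) ≤ t * inner ℝ (A v) (A₀ v) := by
    apply mul_le_mul_of_nonneg_left _ ht
    linarith
  linarith

/-- The error is quadratic in `t`, whereas the gain in `inner_le_of_resolvent` is linear in `t`;
this is what makes it absorbable. -/
theorem inner_sq_le_of_resolvent (hA : ∀ v, A v = A₀ v + t • A₀ (A v)) (hM : ‖A₀‖ ≤ M)
    (v w : E) (hw : ‖w‖ = 1) :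
    inner ℝ (A v) w ^ 2 ≤ 2 * inner ℝ (A₀ v) w ^ 2 + 2 * (t * M) ^ 2 * ‖A v‖ ^ 2 := by
  have h1 : inner ℝ (A v) w = inner ℝ (A₀ v) w + t * inner ℝ (A₀ (A v)) w := by
    conv_lhs => rw [hA v]
    rw [inner_add_left, real_inner_smul_left]
  have h2 : |inner ℝ (A₀ (A v)) w| ≤ M * ‖A v‖ := by
    calc |inner ℝ (A₀ (A v)) w| ≤ ‖A₀ (A v)‖ * ‖w‖ := abs_real_inner_le_norm _ _
      _ ≤ M * ‖A v‖ := by rw [hw, mul_one]; exact A₀.le_of_opNorm_le hM _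
  have h3 : inner ℝ (A₀ (A v)) w ^ 2 ≤ (M * ‖A v‖) ^ 2 := sq_le_sq' (abs_le.mp h2).1 (abs_le.mp h2).2
  have h4 : t ^ 2 * inner ℝ (A₀ (A v)) w ^ 2 ≤ t ^ 2 * (M * ‖A v‖) ^ 2 := by gcongr
  rw [h1]
  nlinarith [sq_nonneg (inner ℝ (A₀ v) w - t * inner ℝ (A₀ (A v)) w)]

/-- If the mixed terms of `A₀` are controlled by its Levi form, the same holds for `A`. -/
theorem mixed_sq_le_levi_of_resolvent (hsymm : ∀ v w, inner ℝ (A₀ v) w = inner ℝ (A₀ w) v)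
    (hA : ∀ v, A v = A₀ v + t • A₀ (A v)) (hM : ‖A₀‖ ≤ M) (ht : 0 ≤ t) (ht1 : t ≤ 1)
    (htM : t * M ≤ 1 / 2) {X Y T : E} (hT : ‖T‖ = 1) {C : ℝ}
    (hF : 0 ≤ inner ℝ (A₀ X) X + inner ℝ (A₀ Y) Y)
    (hS : inner ℝ (A₀ X) T ^ 2 + inner ℝ (A₀ Y) T ^ 2
      ≤ C * (inner ℝ (A₀ X) X + inner ℝ (A₀ Y) Y)) :
    0 ≤ inner ℝ (A X) X + inner ℝ (A Y) Y ∧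
    inner ℝ (A X) T ^ 2 + inner ℝ (A Y) T ^ 2
      ≤ (2 * |C| + 4 * M ^ 2) * (inner ℝ (A X) X + inner ℝ (A Y) Y) := by
  have hX := inner_le_of_resolvent hsymm hA hM ht htM X
  have hY := inner_le_of_resolvent hsymm hA hM ht htM Y
  have hXT := inner_sq_le_of_resolvent hA hM X T hT
  have hYT := inner_sq_le_of_resolvent hA hM Y T hT
  set F := inner ℝ (A X) X + inner ℝ (A Y) Y with hFdef
  set F₀ := inner ℝ (A₀ X) X + inner ℝ (A₀ Y) Y with hF0def
  set G := ‖A X‖ ^ 2 + ‖A Y‖ ^ 2 with hG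
  have hG0 : 0 ≤ G := by positivity
  have h1 : F₀ + t / 2 * G ≤ F := by rw [hFdef, hF0def, hG]; linarith
  have htG : 0 ≤ t / 2 * G := by positivity
  have h2 : C * F₀ ≤ |C| * F :=
    (mul_le_mul_of_nonneg_right (le_abs_self C) hF).trans (by gcongr; linarith)
  -- Here `t ≤ 1` enters; together with `t G ≤ 2 F` it turns the quadratic error into a multiple of
  -- `F`.
  have h3 : t ^ 2 * G ≤ t * G := by
    apply mul_le_mul_of_nonneg_right _ hG0
    nlinarith
  have h4 : M ^ 2 * (t ^ 2 * G) ≤ M ^ 2 * (2 * F) := by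
    apply mul_le_mul_of_nonneg_left _ (sq_nonneg M)
    linarith
  refine ⟨by linarith, ?_⟩
  calc inner ℝ (A X) T ^ 2 + inner ℝ (A Y) T ^ 2
      ≤ 2 * (inner ℝ (A₀ X) T ^ 2 + inner ℝ (A₀ Y) T ^ 2) + 2 * (M ^ 2 * (t ^ 2 * G)) := by
        rw [hG]; linarith
    _ ≤ 2 * (|C| * F) + 2 * (M ^ 2 * (2 * F)) := by linarith
    _ = _ := by ring

end Operator

/-! ### Complex Hessian, canonical frame and Levi form in real terms -/

namespace C2

theorem real_inner_eq (v w : C2) :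
    inner ℝ v w = (v 0).re * (w 0).re + (v 0).im * (w 0).im
      + ((v 1).re * (w 1).re + (v 1).im * (w 1).im) := by
  simp [PiLp.inner_apply, Complex.inner, Fin.sum_univ_two]
  ring

theorem eq_sum_basisVec (v : C2) :
    v = (v 0).re • basisVec 0 + (v 0).im • (Complex.I • basisVec 0)
      + ((v 1).re • basisVec 1 + (v 1).im • (Complex.I • basisVec 1)) := by
  ext j
  fin_cases j <;> simp [basisVec]

theorem fderiv_toComplex {r : C2 → ℝ} {q : C2} (hr : DifferentiableAt ℝ r q) (v : C2) :
    fderiv ℝ (toComplex r) q v = (fderiv ℝ r q v : ℂ) := by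
  have h : HasFDerivAt (toComplex r) (Complex.ofRealCLM.comp (fderiv ℝ r q)) q :=
    Complex.ofRealCLM.hasFDerivAt.comp q hr.hasFDerivAt
  rw [h.fderiv]
  simp

theorem dz_toComplex {r : C2 → ℝ} {q : C2} (hr : DifferentiableAt ℝ r q) (j : Fin 2) :
    dz j (toComplex r) q = (1 / 2 : ℂ) * ((fderiv ℝ r q (basisVec j) : ℂ)
      - Complex.I * (fderiv ℝ r q (Complex.I • basisVec j) : ℂ)) := by
  rw [dz, fderiv_toComplex hr, fderiv_toComplex hr]

theorem dzbar_toComplex {r : C2 → ℝ} {q : C2} (hr : DifferentiableAt ℝ r q) (j : Fin 2) :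
    dzbar j (toComplex r) q = (1 / 2 : ℂ) * ((fderiv ℝ r q (basisVec j) : ℂ)
      + Complex.I * (fderiv ℝ r q (Complex.I • basisVec j) : ℂ)) := by
  rw [dzbar, fderiv_toComplex hr, fderiv_toComplex hr]

theorem dz_dzbar_toComplex {r : C2 → ℝ} {q : C2} (hr : ContDiffAt ℝ ∞ r q) (j k : Fin 2) :
    dz j (dzbar k (toComplex r)) q = (1 / 4 : ℂ) *
      ((realHessian r q (basisVec j) (basisVec k) : ℂ)
        + (realHessian r q (Complex.I • basisVec j) (Complex.I • basisVec k) : ℂ)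
        + Complex.I * ((realHessian r q (basisVec j) (Complex.I • basisVec k) : ℂ)
          - (realHessian r q (Complex.I • basisVec j) (basisVec k) : ℂ))) := by
  have hev : dzbar k (toComplex r) =ᶠ[𝓝 q] fun y => (1 / 2 : ℂ) *
      ((fderiv ℝ r y (basisVec k) : ℂ)
        + Complex.I * (fderiv ℝ r y (Complex.I • basisVec k) : ℂ)) := by
    have h1 : ContDiffAt ℝ 1 r q := hr.of_le (WithTop.coe_le_coe.2 le_top)
    filter_upwards [h1.eventually (by simp)] with y hy
      using dzbar_toComplex (hy.differentiableAt (by simp)) k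
  have hd : HasFDerivAt (fderiv ℝ r) (fderiv ℝ (fderiv ℝ r) q) q := by
    have : ContDiffAt ℝ ∞ (fderiv ℝ r) q := hr.fderiv_right (by simp)
    exact (this.differentiableAt (by simp)).hasFDerivAt
  have hw : ∀ w : C2, HasFDerivAt (fun y => (fderiv ℝ r y w : ℂ))
      (Complex.ofRealCLM.comp ((fderiv ℝ (fderiv ℝ r) q).flip w)) q := by
    intro w
    have h1 : HasFDerivAt (fun y => fderiv ℝ r y w) ((fderiv ℝ (fderiv ℝ r) q).flip w) q :=
      (hd.clm_apply (hasFDerivAt_const w q)).congr_fderiv (by ext; simp)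
    exact Complex.ofRealCLM.hasFDerivAt.comp q h1
  have h2 := ((hw (basisVec k)).add
    ((hw (Complex.I • basisVec k)).const_mul Complex.I)).const_mul (1 / 2 : ℂ)
  have h3 := h2.congr_of_eventuallyEq hev
  rw [dz, h3.fderiv]
  simp only [realHessian, add_apply, smul_apply, ContinuousLinearMap.comp_apply,
    ContinuousLinearMap.flip_apply, Complex.ofRealCLM_apply, smul_eq_mul]
  linear_combination (-(1 / 4) : ℂ) *
    (fderiv ℝ (fderiv ℝ r) q (Complex.I • basisVec j) (Complex.I • basisVec k)) * Complex.I_sq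

/-- The Levi form in terms of the real Hessian. -/
theorem complexHessian_self_re {r : C2 → ℝ} {q : C2} (hr : ContDiffAt ℝ ∞ r q) (ξ : C2) :
    (complexHessian r q ξ ξ).re =
      1 / 4 * (realHessian r q ξ ξ + realHessian r q (Complex.I • ξ) (Complex.I • ξ)) := by
  have h1 : Complex.I • ξ = (-(ξ 0).im) • basisVec 0 + (ξ 0).re • (Complex.I • basisVec 0)
      + ((-(ξ 1).im) • basisVec 1 + (ξ 1).re • (Complex.I • basisVec 1)) := by
    rw [eq_sum_basisVec (Complex.I • ξ)]
    simp
  have h2 := congrArg (fun v => realHessian r q v v) (eq_sum_basisVec ξ)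
  simp only at h2
  rw [h1, h2]
  simp only [complexHessian, Fin.sum_univ_two, dz_dzbar_toComplex hr, realHessian]
  generalize fderiv ℝ (fderiv ℝ r) q = B
  generalize Complex.I • basisVec 0 = f₀
  generalize Complex.I • basisVec 1 = f₁
  generalize basisVec 0 = e₀
  generalize basisVec 1 = e₁
  have h4 : (1 / 4 : ℂ) = ((1 / 4 : ℝ) : ℂ) := by push_cast; rfl
  simp only [map_add, map_smul, add_apply, smul_apply, smul_eq_mul, h4, Complex.add_re,
    Complex.add_im, Complex.mul_re, Complex.mul_im, Complex.sub_re, Complex.sub_im,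
    Complex.ofReal_re, Complex.ofReal_im, Complex.I_re, Complex.I_im, Complex.conj_re,
    Complex.conj_im]
  ring

/-- The complex tangential vector attached to a complex normal vector. -/
noncomputable def tangential (n : C2) : C2 := !₂[conj (n 1), -conj (n 0)]

@[simp] theorem tangential_zero (n : C2) : tangential n 0 = conj (n 1) := rfl

@[simp] theorem tangential_one (n : C2) : tangential n 1 = -conj (n 0) := rfl

theorem inner_tangential (n : C2) : inner ℝ n (tangential n) = 0 := by
  simp [real_inner_eq]; ring

theorem inner_I_tangential (n : C2) : inner ℝ n (Complex.I • tangential n) = 0 := by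
  simp [real_inner_eq]; ring

theorem inner_I_self (n : C2) : inner ℝ n (Complex.I • n) = 0 := by
  simp [real_inner_eq]; ring

theorem norm_sq_eq (n : C2) :
    ‖n‖ ^ 2 = (n 0).re ^ 2 + (n 0).im ^ 2 + ((n 1).re ^ 2 + (n 1).im ^ 2) := by
  rw [← real_inner_self_eq_norm_sq, real_inner_eq]; ring

section Fields

variable {r : C2 → ℝ} {q n : C2} {c : ℝ}

theorem dz_of_fderiv (hr : DifferentiableAt ℝ r q) (h : ∀ v, fderiv ℝ r q v = c * inner ℝ n v)
    (j : Fin 2) : dz j (toComplex r) q = (c / 2 : ℝ) * conj (n j) := by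
  rw [dz_toComplex hr, h, h]
  fin_cases j <;> simp [real_inner_eq, basisVec, Complex.ext_iff] <;>
    constructor <;> ring

theorem dzbar_of_fderiv (hr : DifferentiableAt ℝ r q)
    (h : ∀ v, fderiv ℝ r q v = c * inner ℝ n v) (j : Fin 2) :
    dzbar j (toComplex r) q = (c / 2 : ℝ) * n j := by
  rw [dzbar_toComplex hr, h, h]
  fin_cases j <;> simp [real_inner_eq, basisVec, Complex.ext_iff] <;>
    constructor <;> ring

/-- Here `c` is the length of the real gradient and `|∂r| = c / √2`. The factor `2 / c` cancels the
`c / 2` in the Wirtinger derivatives, so the canonical fields depend only on the unit normal. -/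
theorem sqrt_two_div_delNorm (hr : DifferentiableAt ℝ r q)
    (h : ∀ v, fderiv ℝ r q v = c * inner ℝ n v) (hc : 0 < c) (hn : ‖n‖ = 1) :
    Real.sqrt 2 / delNorm r q = 2 / c := by
  have h1 : 2 * ∑ j : Fin 2, ‖dz j (toComplex r) q‖ ^ 2 = c ^ 2 / 2 := by
    have h2 := norm_sq_eq n
    rw [hn] at h2
    simp only [Fin.sum_univ_two, dz_of_fderiv hr h, norm_mul, RCLike.norm_conj, mul_pow,
      Complex.sq_norm, Complex.normSq_apply, Complex.ofReal_re, Complex.ofReal_im]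
    linear_combination (- c ^ 2 / 2) * h2
  rw [delNorm, h1, Real.sqrt_div (sq_nonneg c), Real.sqrt_sq hc.le]
  field_simp
  rw [Real.sq_sqrt zero_le_two]

theorem fieldN_eq (hr : DifferentiableAt ℝ r q) (h : ∀ v, fderiv ℝ r q v = c * inner ℝ n v)
    (hc : 0 < c) (hn : ‖n‖ = 1) : fieldN r q = n := by
  rw [fieldN, sqrt_two_div_delNorm hr h hc hn, dzbar_of_fderiv hr h, dzbar_of_fderiv hr h]
  have hc' : (c : ℂ) ≠ 0 := by exact_mod_cast hc.ne'
  ext j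
  fin_cases j <;> simp <;> field_simp

theorem fieldL_eq (hr : DifferentiableAt ℝ r q) (h : ∀ v, fderiv ℝ r q v = c * inner ℝ n v)
    (hc : 0 < c) (hn : ‖n‖ = 1) : fieldL r q = tangential n := by
  rw [fieldL, sqrt_two_div_delNorm hr h hc hn, dz_of_fderiv hr h, dz_of_fderiv hr h]
  have hc' : (c : ℂ) ≠ 0 := by exact_mod_cast hc.ne'
  ext j
  fin_cases j <;> simp <;> field_simp

theorem del_tangential (hr : DifferentiableAt ℝ r q)
    (h : ∀ v, fderiv ℝ r q v = c * inner ℝ n v) : del r q (tangential n) = 0 := by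
  simp only [del, Fin.sum_univ_two, dz_of_fderiv hr h, tangential_zero, tangential_one]
  ring

end Fields

/-- Cauchy–Schwarz followed by the arithmetic–geometric mean inequality: `2|pu + qw| ≤ 2√(αF · Cβ) ≤
αF + Cβ`. -/
theorem two_mul_mixed_add_nonneg {α β F C p q u w : ℝ} (hα : 0 ≤ α) (hβ : 0 ≤ β) (hF : 0 ≤ F)
    (hC : 0 ≤ C) (huw : u ^ 2 + w ^ 2 = α * β) (hpq : p ^ 2 + q ^ 2 ≤ C * F) :
    0 ≤ α * F + 2 * (p * u + q * w) + C * β := by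
  have h1 : (2 * (p * u + q * w)) ^ 2 ≤ (α * F + C * β) ^ 2 := by
    have h2 : (p * u + q * w) ^ 2 ≤ (p ^ 2 + q ^ 2) * (u ^ 2 + w ^ 2) := by
      linarith [sq_nonneg (p * w - q * u)]
    have h3 : (p ^ 2 + q ^ 2) * (u ^ 2 + w ^ 2) ≤ C * F * (α * β) := by
      rw [huw]
      gcongr
    linarith [sq_nonneg (α * F - C * β)]
  have h4 := (abs_le_of_sq_le_sq' h1 (by positivity)).1
  linarith

/-- Lower bound for the Levi form of a distance function with shape operator `A`, in terms of the
complex normal component. -/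
theorem levi_lower_bound {A : C2 →L[ℝ] C2} {n : C2} {C M : ℝ}
    (hsymm : ∀ v w, inner ℝ (A v) w = inner ℝ (A w) v) (hn : ‖n‖ = 1) (hAn : A n = 0)
    (hM : ‖A‖ ≤ M) (hC : 0 ≤ C)
    (hF : 0 ≤ inner ℝ (A (tangential n)) (tangential n)
      + inner ℝ (A (Complex.I • tangential n)) (Complex.I • tangential n))
    (hS : inner ℝ (A (tangential n)) (Complex.I • n) ^ 2
        + inner ℝ (A (Complex.I • tangential n)) (Complex.I • n) ^ 2
      ≤ C * (inner ℝ (A (tangential n)) (tangential n)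
        + inner ℝ (A (Complex.I • tangential n)) (Complex.I • tangential n))) (ξ : C2) :
    -(C + M) * (inner ℝ n ξ ^ 2 + inner ℝ n (Complex.I • ξ) ^ 2)
      ≤ inner ℝ (A ξ) ξ + inner ℝ (A (Complex.I • ξ)) (Complex.I • ξ) := by
  have hn2 := norm_sq_eq n
  rw [hn] at hn2
  have hnC : conj (n 0) * n 0 + conj (n 1) * n 1 = 1 := by
    apply Complex.ext
    · simp; linarith
    · simp; ring
  set a : ℂ := n 1 * ξ 0 - n 0 * ξ 1 with ha
  set b : ℂ := conj (n 0) * ξ 0 + conj (n 1) * ξ 1 with hb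
  set X := tangential n with hX
  have hξ : ξ = a.re • X + a.im • (Complex.I • X) + (b.re • n + b.im • (Complex.I • n)) := by
    have h1 : ξ = a • X + b • n := by
      ext j
      fin_cases j
      · simp [ha, hb, hX]; linear_combination (-ξ 0) * hnC
      · simp [ha, hb, hX]; linear_combination (-ξ 1) * hnC
    have h2 : ∀ (c : ℂ) (v : C2), c • v = c.re • v + c.im • (Complex.I • v) := by
      intro c v
      ext j
      simp [Complex.ext_iff]
      ring
    rw [← h2, ← h2]
    exact h1
  have hIξ : Complex.I • ξ = (-a.im) • X + a.re • (Complex.I • X)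
      + ((-b.im) • n + b.re • (Complex.I • n)) := by
    have h2 : ∀ (s : ℝ) (v : C2), Complex.I • s • v = s • Complex.I • v :=
      fun s v => smul_comm _ _ _
    have h3 : ∀ v : C2, Complex.I • Complex.I • v = -v := by
      intro v; rw [smul_smul, Complex.I_mul_I, neg_one_smul]
    conv_lhs => rw [hξ]
    simp only [smul_add, h2, h3]
    module
  have hb1 : inner ℝ n ξ = b.re := by simp [real_inner_eq, hb]
  have hb2 : inner ℝ n (Complex.I • ξ) = -b.im := by simp [real_inner_eq, hb]; ring
  have hAN : ∀ v, inner ℝ (A v) n = 0 := fun v => by rw [hsymm, hAn, inner_zero_left]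
  have hIn : ‖Complex.I • n‖ = 1 := by rw [norm_smul, Complex.norm_I, hn, one_mul]
  have hm : -M ≤ inner ℝ (A (Complex.I • n)) (Complex.I • n) := by
    have h1 := abs_real_inner_le_norm (A (Complex.I • n)) (Complex.I • n)
    have h2 := A.le_of_opNorm_le hM (Complex.I • n)
    rw [hIn, mul_one] at h1 h2
    linarith [(abs_le.mp h1).1]
  rw [hb1, hb2, hIξ]
  conv_rhs => rw [hξ]
  -- With `ξ = aX + bn`, summing over `ξ` and `iξ` cancels the cross term between `X` and `iX`. What
  -- remains is `|a|² F`, the mixed terms with coefficients `u` and `w` (real and imaginary parts of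
  -- a product of modulus `|a||b|`), and `|b|²⟨A(in), in⟩`.
  have key := two_mul_mixed_add_nonneg (α := a.re ^ 2 + a.im ^ 2) (β := b.re ^ 2 + b.im ^ 2)
    (u := a.re * b.im - a.im * b.re) (w := a.re * b.re + a.im * b.im)
    (by positivity) (by positivity) hF hC (by ring) hS
  have hm' := mul_le_mul_of_nonneg_left hm (by positivity : 0 ≤ b.re ^ 2 + b.im ^ 2)
  simp only [map_add, map_smul, inner_add_left, inner_add_right, real_inner_smul_left,
    real_inner_smul_right, hAn, inner_zero_left, hAN]
  rw [hsymm (Complex.I • n) X, hsymm (Complex.I • n) (Complex.I • X),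
    hsymm (Complex.I • X) X]
  linarith

end C2

/-! ### Hessian of `δ + K δ²` -/

namespace IsNormalProjection

variable {E : Type*} [NormedAddCommGroup E] [InnerProductSpace ℝ E]
  {W : Set E} {π : E → E} {δ : E → ℝ} {N : E → E} {x : E}

theorem hasFDerivAt_dist_add_sq (h : IsNormalProjection W π δ N) (K : ℝ) (hx : x ∈ W) :
    HasFDerivAt (fun y => δ y + K * δ y ^ 2) ((1 + 2 * K * δ x) • innerSL ℝ (N x)) x := by
  have h1 := h.hasFDerivAt_dist hx
  rw [h.fderiv_dist_eq hx] at h1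
  refine (h1.add ((h1.pow 2).const_mul K)).congr_fderiv ?_
  ext v
  simp
  ring

theorem fderiv_fderiv_dist_add_sq (h : IsNormalProjection W π δ N) (K : ℝ) (hx : x ∈ W) (v : E) :
    fderiv ℝ (fderiv ℝ fun y => δ y + K * δ y ^ 2) x v v =
      (1 + 2 * K * δ x) * inner ℝ (fderiv ℝ N x v) v + 2 * K * inner ℝ (N x) v ^ 2 := by
  have hev : (fderiv ℝ fun y => δ y + K * δ y ^ 2) =ᶠ[𝓝 x]
      fun y => (1 + 2 * K * δ y) • innerSL ℝ (N y) := by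
    filter_upwards [h.eventually_mem hx] with y hy using (h.hasFDerivAt_dist_add_sq K hy).fderiv
  have hN : HasFDerivAt (fun y => innerSL ℝ (N y)) ((innerSL ℝ).comp (fderiv ℝ N x)) x :=
    (innerSL ℝ : E →L[ℝ] E →L[ℝ] ℝ).hasFDerivAt.comp x (h.hasFDerivAt_normal hx)
  have hδ : HasFDerivAt (fun y => 1 + 2 * K * δ y) ((2 * K) • innerSL ℝ (N x)) x := by
    have h1 := h.hasFDerivAt_dist hx
    rw [h.fderiv_dist_eq hx] at h1
    exact (h1.const_mul (2 * K)).const_add 1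
  have hmul : HasFDerivAt (fun y => (1 + 2 * K * δ y) • innerSL ℝ (N y)) _ x := hδ.smul hN
  rw [hev.fderiv_eq, hmul.fderiv]
  simp
  ring

end IsNormalProjection

/-! ### Defining functions versus the signed distance -/

namespace C2

namespace IsLocalDefiningFunction

variable {Ω : Set C2} {p q : C2} {U : Set C2} {r : C2 → ℝ}

theorem contDiffAt (hr : IsLocalDefiningFunction Ω p U r) (hq : q ∈ U) : ContDiffAt ℝ ∞ r q :=
  hr.smooth.contDiffAt (hr.isOpen.mem_nhds hq)

theorem mem_iff (hr : IsLocalDefiningFunction Ω p U r) (hq : q ∈ U) : q ∈ Ω ↔ r q < 0 := by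
  have h := Set.ext_iff.mp hr.inter_eq q
  simpa [hq] using h

theorem nonpos_of_mem_closure (hr : IsLocalDefiningFunction Ω p U r) (hq : q ∈ closure Ω)
    (hqU : q ∈ U) : r q ≤ 0 := by
  by_contra! hpos
  have h1 : ∀ᶠ y in 𝓝 q, 0 < r y ∧ y ∈ U :=
    ((hr.contDiffAt hqU).continuousAt.eventually (lt_mem_nhds hpos)).and
      (hr.isOpen.mem_nhds hqU)
  obtain ⟨y, ⟨hy, hyU⟩, hyΩ⟩ := mem_closure_iff_nhds.mp hq _ h1
  exact absurd ((hr.mem_iff hyU).mp hyΩ) hy.le.not_gt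

theorem eq_zero_of_mem_frontier (hr : IsLocalDefiningFunction Ω p U r) (hΩ : IsOpen Ω)
    (hq : q ∈ frontier Ω) (hqU : q ∈ U) : r q = 0 := by
  rw [hΩ.frontier_eq] at hq
  refine le_antisymm (hr.nonpos_of_mem_closure hq.1 hqU) ?_
  by_contra! h
  exact hq.2 ((hr.mem_iff hqU).mpr h)

end IsLocalDefiningFunction

section Hypersurface

variable {Ω W U : Set C2} {π N : C2 → C2} {δ r : C2 → ℝ} {p q : C2}

/-- If `q` were outside the closure, `δ` would have a local minimum there, contradicting its unit
gradient. -/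
theorem mem_frontier_of_dist_eq_zero (h : IsNormalProjection W π δ N)
    (hW : ∀ x ∈ W, x ∈ Ω ↔ δ x < 0) (hq : q ∈ W) (h0 : δ q = 0) : q ∈ frontier Ω := by
  have hqΩ : q ∉ Ω := fun hmem => by linarith [(hW q hq).mp hmem]
  refine ⟨?_, fun hi => hqΩ (interior_subset hi)⟩
  by_contra hcl
  have hmin : IsLocalMin δ q := by
    filter_upwards [isClosed_closure.isOpen_compl.mem_nhds hcl, h.eventually_mem hq] with y hy hyW
    rw [h0]
    by_contra! hlt
    exact hy (subset_closure ((hW y hyW).mpr hlt))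
  have h1 := h.fderiv_dist q hq (N q)
  rw [hmin.fderiv_eq_zero, real_inner_self_eq_norm_sq, h.norm_normal q hq] at h1
  simp at h1

theorem comp_proj_eq_zero (h : IsNormalProjection W π δ N) (hW : ∀ x ∈ W, x ∈ Ω ↔ δ x < 0)
    (hΩ : IsOpen Ω) (hr : IsLocalDefiningFunction Ω p U r) (hWU : W ⊆ U) :
    ∀ y ∈ W, r (π y) = 0 := fun y hy =>
  hr.eq_zero_of_mem_frontier hΩ
    (mem_frontier_of_dist_eq_zero h hW (h.mapsTo hy) (h.dist_proj y hy)) (hWU (h.mapsTo hy))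

/-- The differential of `r` is nonzero and normal, so its normal derivative is nonzero. The sign
comes from left difference quotients: `q + sN` lies in `Ω` for small `s < 0`, where `r < 0`. -/
theorem normal_derivative_pos (h : IsNormalProjection W π δ N) (hW : ∀ x ∈ W, x ∈ Ω ↔ δ x < 0)
    (hΩ : IsOpen Ω) (hr : IsLocalDefiningFunction Ω p U r) (hWU : W ⊆ U) (hq : q ∈ W)
    (h0 : δ q = 0) : 0 < fderiv ℝ r q (N q) := by
  have hqf := mem_frontier_of_dist_eq_zero h hW hq h0
  have hr0 := hr.eq_zero_of_mem_frontier hΩ hqf (hWU hq)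
  have hne : fderiv ℝ r q (N q) ≠ 0 := by
    intro hz
    apply hr.fderiv_ne_zero q ⟨hqf, hWU hq⟩
    ext v
    rw [h.fderiv_eq_of_comp_proj_eq_zero (fun y hy => hr.contDiffAt (hWU hy))
      (comp_proj_eq_zero h hW hΩ hr hWU) hq h0, hz]
    simp
  refine lt_of_le_of_ne ?_ hne.symm
  have hline : HasDerivAt (fun s : ℝ => q + s • N q) (N q) 0 := by
    simpa using ((hasDerivAt_id (0 : ℝ)).smul_const (N q)).const_add q
  have hq0 : q + (0 : ℝ) • N q = q := by simp
  have hdr : HasDerivAt (fun s : ℝ => r (q + s • N q)) (fderiv ℝ r q (N q)) 0 := by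
    have h1 : HasFDerivAt r (fderiv ℝ r q) (q + (0 : ℝ) • N q) := by
      rw [hq0]
      exact ((hr.contDiffAt (hWU hq)).differentiableAt (by simp)).hasFDerivAt
    exact h1.comp_hasDerivAt 0 hline
  have hdδ : HasDerivAt (fun s : ℝ => δ (q + s • N q)) 1 0 := by
    have h1 : HasFDerivAt δ (fderiv ℝ δ q) (q + (0 : ℝ) • N q) := by
      rw [hq0]
      exact h.hasFDerivAt_dist hq
    have h2 := h1.comp_hasDerivAt 0 hline
    rwa [h.fderiv_dist q hq, real_inner_self_eq_norm_sq, h.norm_normal q hq, one_pow] at h2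
  have hmem : ∀ᶠ s : ℝ in 𝓝 0, q + s • N q ∈ W := by
    apply hline.continuousAt.eventually_mem
    rw [hq0]
    exact h.isOpen.mem_nhds hq
  have hsl := hasDerivAt_iff_tendsto_slope.mp hdr
  have hslδ := hasDerivAt_iff_tendsto_slope.mp hdδ
  have hlt : 𝓝[<] (0 : ℝ) ≤ 𝓝[≠] 0 := nhdsWithin_mono _ fun s (hs : s < 0) => hs.ne
  refine ge_of_tendsto (hsl.mono_left hlt) ?_
  filter_upwards [(hslδ.mono_left hlt).eventually (lt_mem_nhds one_pos),
    hmem.filter_mono nhdsWithin_le_nhds, self_mem_nhdsWithin] with s hs hsW hneg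
  simp only [slope_def_field, hq0, h0, hr0, sub_zero] at hs ⊢
  have hneg' : s < 0 := hneg
  have hδneg : δ (q + s • N q) < 0 := by
    by_contra! hge
    exact absurd hs (div_nonpos_of_nonneg_of_nonpos hge hneg'.le).not_gt
  exact div_nonneg_of_nonpos ((hr.mem_iff (hWU hsW)).mp ((hW _ hsW).mpr hδneg)).le hneg'.le

/-- The Levi form of the shape operator on the complex tangential direction. -/
theorem levi_eq (h : IsNormalProjection W π δ N) (hW : ∀ x ∈ W, x ∈ Ω ↔ δ x < 0)
    (hΩ : IsOpen Ω) (hr : IsLocalDefiningFunction Ω p U r) (hWU : W ⊆ U) (hq : q ∈ W)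
    (h0 : δ q = 0) :
    (complexHessian r q (tangential (N q)) (tangential (N q))).re =
      1 / 4 * (fderiv ℝ r q (N q) * (inner ℝ (fderiv ℝ N q (tangential (N q))) (tangential (N q))
        + inner ℝ (fderiv ℝ N q (Complex.I • tangential (N q)))
          (Complex.I • tangential (N q)))) := by
  have hD := fun {v w} => h.fderiv_fderiv_eq_of_comp_proj_eq_zero (v := v) (w := w)
    (fun y hy => hr.contDiffAt (hWU hy)) (comp_proj_eq_zero h hW hΩ hr hWU) hq h0
  have hX := inner_tangential (N q)
  have hY := inner_I_tangential (N q)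
  rw [complexHessian_self_re (hr.contDiffAt (hWU hq)), realHessian, realHessian, hD hX hX,
    hD hY hY, ← mul_add]

theorem levi_nonneg (h : IsNormalProjection W π δ N) (hW : ∀ x ∈ W, x ∈ Ω ↔ δ x < 0)
    (hΩ : IsOpen Ω) (hr : IsLocalDefiningFunction Ω p U r) (hWU : W ⊆ U) (hq : q ∈ W)
    (h0 : δ q = 0) (hpsc : ∀ ξ : C2, del r q ξ = 0 → 0 ≤ (complexHessian r q ξ ξ).re) :
    0 ≤ inner ℝ (fderiv ℝ N q (tangential (N q))) (tangential (N q))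
        + inner ℝ (fderiv ℝ N q (Complex.I • tangential (N q)))
          (Complex.I • tangential (N q)) := by
  have h1 := hpsc (tangential (N q)) (del_tangential
    ((hr.contDiffAt (hWU hq)).differentiableAt (by simp))
    (h.fderiv_eq_of_comp_proj_eq_zero (fun y hy => hr.contDiffAt (hWU hy))
      (comp_proj_eq_zero h hW hΩ hr hWU) hq h0))
  rw [levi_eq h hW hΩ hr hWU hq h0] at h1
  exact nonneg_of_mul_nonneg_right (by linarith) (normal_derivative_pos h hW hΩ hr hWU hq h0)

/-- With `k` the normal derivative of `r`, the squared mixed terms scale by `k²` and the Levi form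
by `k / 4`. One factor `k` cancels and the other is bounded below by `c`, whence `C / (4c)`. Signs
in `Y = -iX` and `T = -iN` disappear on squaring. -/
theorem mixed_sq_le_levi (h : IsNormalProjection W π δ N) (hW : ∀ x ∈ W, x ∈ Ω ↔ δ x < 0)
    (hΩ : IsOpen Ω) (hr : IsLocalDefiningFunction Ω p U r) (hWU : W ⊆ U) (hq : q ∈ W)
    (h0 : δ q = 0) {C c : ℝ} (hc : 0 < c) (hcr : c ≤ fderiv ℝ r q (N q))
    (hF : 0 ≤ inner ℝ (fderiv ℝ N q (tangential (N q))) (tangential (N q))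
        + inner ℝ (fderiv ℝ N q (Complex.I • tangential (N q)))
          (Complex.I • tangential (N q)))
    (hS : |realHessian r q (fieldY r q) (fieldT r q) ^ 2
          + realHessian r q (fieldX r q) (fieldT r q) ^ 2|
        ≤ C * |(complexHessian r q (fieldL r q) (fieldL r q)).re|) :
    inner ℝ (fderiv ℝ N q (tangential (N q))) (Complex.I • N q) ^ 2
        + inner ℝ (fderiv ℝ N q (Complex.I • tangential (N q))) (Complex.I • N q) ^ 2
      ≤ C / (4 * c) * (inner ℝ (fderiv ℝ N q (tangential (N q))) (tangential (N q))
        + inner ℝ (fderiv ℝ N q (Complex.I • tangential (N q)))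
          (Complex.I • tangential (N q))) := by
  have hgrad := h.fderiv_eq_of_comp_proj_eq_zero (fun y hy => hr.contDiffAt (hWU hy))
    (comp_proj_eq_zero h hW hΩ hr hWU) hq h0
  have hD := fun {v w} => h.fderiv_fderiv_eq_of_comp_proj_eq_zero (v := v) (w := w)
    (fun y hy => hr.contDiffAt (hWU hy)) (comp_proj_eq_zero h hW hΩ hr hWU) hq h0
  have hd : DifferentiableAt ℝ r q := (hr.contDiffAt (hWU hq)).differentiableAt (by simp)
  have hpos := normal_derivative_pos h hW hΩ hr hWU hq h0
  have hX := inner_tangential (N q)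
  have hY := inner_I_tangential (N q)
  have hT := inner_I_self (N q)
  have hL := fieldL_eq hd hgrad hpos (h.norm_normal q hq)
  have hN := fieldN_eq hd hgrad hpos (h.norm_normal q hq)
  simp only [fieldY, fieldX, fieldT, hL, hN] at hS
  rw [levi_eq h hW hΩ hr hWU hq h0] at hS
  simp only [realHessian, map_neg, neg_apply, neg_neg, neg_sq] at hS
  rw [hD hY hT, hD hX hT] at hS
  set k := fderiv ℝ r q (N q)
  set F := inner ℝ (fderiv ℝ N q (tangential (N q))) (tangential (N q))
        + inner ℝ (fderiv ℝ N q (Complex.I • tangential (N q)))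
          (Complex.I • tangential (N q))
  set u := inner ℝ (fderiv ℝ N q (tangential (N q))) (Complex.I • N q)
  set v := inner ℝ (fderiv ℝ N q (Complex.I • tangential (N q))) (Complex.I • N q)
  rw [abs_of_nonneg (by positivity), abs_of_nonneg (by positivity)] at hS
  have h1 : k * (u ^ 2 + v ^ 2) ≤ C / 4 * F := by
    refine le_of_mul_le_mul_left ?_ hpos
    linarith
  have h2 : c * (u ^ 2 + v ^ 2) ≤ C / 4 * F :=
    (mul_le_mul_of_nonneg_right hcr (by positivity)).trans h1
  have h3 : C / (4 * c) * F = C / 4 * F / c := by field_simp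
  rw [h3, le_div_iff₀ hc]
  linarith

/-- The Levi form of the signed distance function on the pseudoconvex side. -/
theorem levi_dist_lower_bound (h : IsNormalProjection W π δ N) {x : C2} (hx : x ∈ W) {C M : ℝ}
    (hδ : δ x ≤ 0) (hδ1 : -1 ≤ δ x) (hδM : -δ x * M ≤ 1 / 2) (hM : ‖fderiv ℝ N x‖ ≤ M)
    (hM₀ : ‖fderiv ℝ N (π x)‖ ≤ M)
    (hF : 0 ≤ inner ℝ (fderiv ℝ N (π x) (tangential (N x))) (tangential (N x))
        + inner ℝ (fderiv ℝ N (π x) (Complex.I • tangential (N x)))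
          (Complex.I • tangential (N x)))
    (hS : inner ℝ (fderiv ℝ N (π x) (tangential (N x))) (Complex.I • N x) ^ 2
        + inner ℝ (fderiv ℝ N (π x) (Complex.I • tangential (N x))) (Complex.I • N x) ^ 2
      ≤ C * (inner ℝ (fderiv ℝ N (π x) (tangential (N x))) (tangential (N x))
        + inner ℝ (fderiv ℝ N (π x) (Complex.I • tangential (N x)))
          (Complex.I • tangential (N x)))) (ξ : C2) :
    -(2 * |C| + 4 * M ^ 2 + M) * (inner ℝ (N x) ξ ^ 2 + inner ℝ (N x) (Complex.I • ξ) ^ 2)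
      ≤ inner ℝ (fderiv ℝ N x ξ) ξ + inner ℝ (fderiv ℝ N x (Complex.I • ξ)) (Complex.I • ξ) := by
  have hIn : ‖Complex.I • N x‖ = 1 := by
    rw [norm_smul, Complex.norm_I, h.norm_normal x hx, one_mul]
  obtain ⟨h1, h2⟩ := mixed_sq_le_levi_of_resolvent (A := fderiv ℝ N x) (t := -δ x)
    (h.inner_fderiv_normal_comm (h.mapsTo hx))
    (fun v => by
      conv_lhs => rw [h.fderiv_normal_proj hx v]
      rw [neg_smul, sub_eq_add_neg])
    hM₀ (by linarith) (by linarith) hδM hIn hF hS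
  exact levi_lower_bound (h.inner_fderiv_normal_comm hx) (h.norm_normal x hx)
    (h.fderiv_normal_normal hx) hM (by positivity) h1 h2 ξ

end Hypersurface

end C2

/-! ### Choice of constants and conclusion -/

theorem propositionP (Ω : Set C2) (hΩ : C2.IsSmoothlyBoundedDomain Ω)
    (p₀ : C2) (hp₀ : p₀ ∈ frontier Ω) (hs : C2.IsSesquiconvexAt Ω p₀) :
    ∃ (U : Set C2) (ρ : C2 → ℝ), C2.IsLocalDefiningFunction Ω p₀ U ρ ∧
      C2.IsPlurisubharmonicOn ρ (closure Ω ∩ U) := by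
  obtain ⟨⟨U₁, r, hr, hpsc⟩, U₂, ρ, hρ, hO⟩ := hs
  have hΩo := hΩ.isOpen
  obtain ⟨ε, hε, hball⟩ := Metric.nhds_basis_closedBall.mem_iff.mp (hρ.isOpen.mem_nhds hρ.mem)
  obtain ⟨C, hC, hK⟩ := hO (Metric.closedBall p₀ ε ∩ frontier Ω)
    ((isCompact_closedBall p₀ ε).inter_right isClosed_frontier)
    (fun q hq => ⟨hq.2, hball hq.1⟩)
  rw [eventually_nhdsWithin_iff] at hpsc
  have hS := ((hpsc.and (hr.isOpen.mem_nhds hr.mem)).and (hρ.isOpen.mem_nhds hρ.mem)).and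
    (Metric.closedBall_mem_nhds p₀ hε)
  obtain ⟨W, π, δ, N, h, hpW, hWS, hsign⟩ := exists_isNormalProjection (f := ρ) (p := p₀)
    (by filter_upwards [hρ.isOpen.mem_nhds hρ.mem] with x hx using hρ.contDiffAt hx)
    (hρ.eq_zero_of_mem_frontier hΩo hp₀ hρ.mem) (hρ.fderiv_ne_zero p₀ ⟨hp₀, hρ.mem⟩) hS
  have hWr : W ⊆ U₁ := fun x hx => (hWS hx).1.1.2
  have hWρ : W ⊆ U₂ := fun x hx => (hWS hx).1.2
  have hW : ∀ x ∈ W, x ∈ Ω ↔ δ x < 0 := fun x hx =>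
    (hρ.mem_iff (hWρ hx)).trans (hsign x hx).1
  have hδp : δ p₀ = 0 :=
    (hsign p₀ hpW).2.mp (hρ.eq_zero_of_mem_frontier hΩo hp₀ hρ.mem)
  have hπp : π p₀ = p₀ := h.proj_eq_self hpW hδp
  have hc := C2.normal_derivative_pos h hW hΩo hρ hWρ hpW hδp
  set c := fderiv ℝ ρ p₀ (N p₀) / 2 with hcdef
  have hc0 : 0 < c := by positivity
  set M := ‖fderiv ℝ N p₀‖ + 1 with hMdef
  have hM0 : 0 < M := by positivity
  -- Exactly the deficit constant of `levi_dist_lower_bound`, with the boundary constant `C / (4c)`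
  -- from `mixed_sq_le_levi`.
  set K := 2 * |C / (4 * c)| + 4 * M ^ 2 + M with hKdef
  have hK0 : 0 < K := by positivity
  have hcontδ : Tendsto δ (𝓝 p₀) (𝓝 0) := by
    have := (h.contDiffAt_dist hpW).continuousAt
    rwa [ContinuousAt, hδp] at this
  have hcontπ : Tendsto π (𝓝 p₀) (𝓝 p₀) := by
    have := (h.contDiffAt_proj hpW).continuousAt
    rwa [ContinuousAt, hπp] at this
  have hcontA : ContinuousAt (fderiv ℝ N) p₀ :=
    ((h.contDiffAt_normal hpW).fderiv_right (m := 0) (by simp)).continuousAt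
  have hevA : ∀ᶠ x in 𝓝 p₀, ‖fderiv ℝ N x‖ < M :=
    hcontA.norm.eventually (gt_mem_nhds (by rw [hMdef]; linarith))
  have hevc : ∀ᶠ x in 𝓝 p₀, c < fderiv ℝ ρ x (N x) := by
    have h1 : ContinuousAt (fderiv ℝ ρ) p₀ :=
      ((hρ.contDiffAt hρ.mem).fderiv_right (m := 0) (by simp)).continuousAt
    have h2 : ContinuousAt N p₀ := (h.contDiffAt_normal hpW).continuousAt
    exact (h1.clm_apply h2).eventually (lt_mem_nhds (by rw [hcdef]; linarith))
  -- The three bounds give `t ≤ 1` and `t M ≤ 1/2` for the transport with `t = -δ`, and `|Kδ| <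
  -- 1/4`, which keeps `1 + Kδ` and `1 + 2Kδ` positive.
  set η := min 1 (min (1 / (2 * M)) (1 / (4 * K))) with hη
  have hη0 : 0 < η := by positivity
  have hevδ : ∀ᶠ x in 𝓝 p₀, |δ x| < η := by
    have := hcontδ.abs
    rw [abs_zero] at this
    exact this.eventually (gt_mem_nhds hη0)
  obtain ⟨U, hU, hUo, hpU⟩ := eventually_nhds_iff.mp
    ((h.eventually_mem hpW).and (hevδ.and (hevA.and (hcontπ.eventually (hevA.and hevc)))))
  have hUK : ∀ x ∈ U, |K * δ x| < 1 / 4 := by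
    intro x hx
    have h1 : |δ x| < 1 / (4 * K) :=
      (hU x hx).2.1.trans_le ((min_le_right _ _).trans (min_le_right _ _))
    rw [abs_mul, abs_of_pos hK0]
    rw [lt_div_iff₀ (by positivity)] at h1
    linarith
  refine ⟨U, fun y => δ y + K * δ y ^ 2, ⟨hUo, hpU, ?_, ?_, ?_⟩, ?_⟩
  · intro x hx
    have := h.contDiffAt_dist (hU x hx).1
    exact (this.add (contDiffAt_const.mul (this.pow 2))).contDiffWithinAt
  · ext x
    constructor
    · rintro ⟨hxΩ, hx⟩
      refine ⟨hx, ?_⟩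
      have h1 := (hW x (hU x hx).1).mp hxΩ
      have h2 := (abs_lt.mp (hUK x hx)).1
      have : δ x * (1 + K * δ x) < 0 := mul_neg_of_neg_of_pos h1 (by linarith)
      linarith
    · rintro ⟨hx, hneg⟩
      refine ⟨(hW x (hU x hx).1).mpr ?_, hx⟩
      have h2 := (abs_lt.mp (hUK x hx)).1
      by_contra! hge
      have : 0 ≤ δ x * (1 + K * δ x) := mul_nonneg hge (by linarith)
      linarith
  · rintro x ⟨-, hx⟩ hzero
    have hxW := (hU x hx).1
    rw [(h.hasFDerivAt_dist_add_sq K hxW).fderiv] at hzero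
    have h1 := congrArg (fun l => l (N x)) hzero
    have h2 := (abs_lt.mp (hUK x hx)).1
    simp [h.norm_normal x hxW] at h1
    linarith
  · rintro x ⟨hxcl, hx⟩ ξ
    obtain ⟨hxW, hxδ, hxM, hxM₀, hxc⟩ := hU x hx
    have hδ0 : δ x ≤ 0 := by
      have h1 := hρ.nonpos_of_mem_closure hxcl (hWρ hxW)
      by_contra! hpos
      rcases h1.lt_or_eq with h2 | h2
      · linarith [(hsign x hxW).1.mp h2]
      · linarith [(hsign x hxW).2.mp h2]
    have hπW := h.mapsTo hxW
    have hπ0 := h.dist_proj x hxW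
    have hπf := C2.mem_frontier_of_dist_eq_zero h hW hπW hπ0
    -- Pseudoconvexity is used through `r` and the mixed estimate through `ρ`, both at the foot
    -- point `π x`; the common shape operator lets them be combined.
    have hF := C2.levi_nonneg h hW hΩo hr hWr hπW hπ0 ((hWS hπW).1.1.1 hπf)
    have hSS := C2.mixed_sq_le_levi h hW hΩo hρ hWρ hπW hπ0 hc0 hxc.le hF
      (hK (π x) ⟨(hWS hπW).2, hπf⟩)
    rw [h.normal_proj x hxW] at hF hSS
    have hδ1 : -δ x < η := by rwa [abs_of_nonpos hδ0] at hxδ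
    have hδM : -δ x * M ≤ 1 / 2 := by
      have h1 : -δ x < 1 / (2 * M) := hδ1.trans_le ((min_le_right _ _).trans (min_le_left _ _))
      rw [lt_div_iff₀ (by positivity)] at h1
      linarith
    have key := C2.levi_dist_lower_bound h hxW hδ0
      (by linarith [min_le_left 1 (min (1 / (2 * M)) (1 / (4 * K)))]) hδM hxM.le hxM₀.le hF hSS ξ
    have hsm : ContDiffAt ℝ ∞ (fun y => δ y + K * δ y ^ 2) x := by
      have := h.contDiffAt_dist hxW
      exact this.add (contDiffAt_const.mul (this.pow 2))
    rw [C2.complexHessian_self_re hsm, C2.realHessian, C2.realHessian,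
      h.fderiv_fderiv_dist_add_sq K hxW, h.fderiv_fderiv_dist_add_sq K hxW]
    rw [← hKdef] at key
    set b := inner ℝ (N x) ξ ^ 2 + inner ℝ (N x) (Complex.I • ξ) ^ 2 with hb
    have hb0 : 0 ≤ b := by positivity
    have h2 := (abs_lt.mp (hUK x hx)).1
    have h3 := mul_le_mul_of_nonneg_left key (by linarith : 0 ≤ 1 + 2 * K * δ x)
    have h4 : 0 ≤ (-δ x) * K * (K * b) := by
      have : 0 ≤ -δ x := by linarith
      positivity
    have h5 : 0 ≤ K * b := by positivity
    -- The expression equals `K b + 2(-δ)K · K b`, and both terms are nonnegative because `δ ≤ 0`.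
    have h6 : 0 ≤ (1 + 2 * K * δ x) * (-K * b) + 2 * K * b := by linarith
    have h7 : 2 * K * b = 2 * K * inner ℝ (N x) ξ ^ 2
      + 2 * K * inner ℝ (N x) (Complex.I • ξ) ^ 2 := by rw [hb]; ring
    linarith
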